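/- Logarithms are to the base $2$. A set $\mathcal X\subset\mathbb R^{d_x}$ is $\Delta$-separated if $\sup\|x-x'\|_2<\Delta\cdot\inf\|x-x'\|_2$, where the supremum and the infimum are over $x,x'\in\mathcal X$ with $x\ne x'$ (a one-point set counts as $\Delta$-separated). A function $\sigma:\mathbb R\to\mathbb R$ is sigmoidal if the limits $\lim_{x\to-\infty}\sigma(x)$ and $\lim_{x\to\infty}\sigma(x)$ exist and are different, and there is $z\in\mathbb R$ such that $\sigma$ is continuously differentiable at $z$ (differentiable near $z$, with derivative continuous at $z$) and $\sigma'(z)\neq0$. A $\sigma$ network with input dimension $d_x$, $k$ hidden layers and hidden layer dimensions $d_1,\dots,d_k$ is the family of functions $f_\theta=t_k\circ\sigma\circ\cdots\circ t_1\circ\sigma\circ t_0:\mathbb R^{d_x}\to\mathbb R$, where $t_\ell:\mathbb R^{d_\ell}\to\mathbb R^{d_{\ell+1}}$ are affine maps ($d_0=d_x$, $d_{k+1}=1$), $\sigma$ acts coordinatewise, and the parameter $\theta$ consists of all weights and biases of $t_0,\dots,t_k$; its width is $\max_{1\le\ell\le k} d_\ell$. The network can memorize the pairs $\{(x,y(x))\}_{x\in\mathcal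 X}$, where $y:\mathcal X\to\{0,\dots,C-1\}$, if for every $\varepsilon>0$ there is $\theta$ with $|f_\theta(x)-y(x)|\le\varepsilon$ for all $x\in\mathcal X$. **Theorem.** There are universal constants $c_1,c_2>0$ such that the following holds for all positive integers $C,N,d_x$, every real $\Delta\ge1$ and every sigmoidal $\sigma$. Put $$q:=\max\bigl\{1,\ \log d_x+\log\Delta+N^{2/3}\log C\bigr\}.$$ There is a $\sigma$ network architecture of input dimension $d_x$ and width $3$ (in fact with exactly three neurons in each hidden layer), whose number $k$ of hidden layers satisfies $c_1q\le k\le c_2q$, that can memorize every $\Delta$-separated set of $N$ pairs in dimension $d_x$ with $C$ classes, that is, $\{(x,y(x))\}_{x\in\mathcal X}$ for every $\Delta$-separated $\mathcal X\subset\mathbb R^{d_x}$ with $|\mathcal X|=N$ and every $y:\mathcal X\to\{0,\dots,C-1\}$. (If $C\ge2$, the maximum with $1$ is superfluous, so that $k=\Theta(\log d_x+\log\Delta+N^{2/3}\log C)$.) -/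

import Mathlib

open Filter Topology

/-- A set `X ⊆ ℝ^d` is `Δ`-separated if the supremum of the Euclidean distances between distinct
points is smaller than `Δ` times their infimum. Both are taken in `[0, ∞]`, so that the supremum is
`∞` for an unbounded set, and a set with at most one point (infimum `∞`) is `Δ`-separated for
every `Δ > 0`. -/
def IsDeltaSeparated {d : ℕ} (Δ : ℝ) (X : Set (EuclideanSpace ℝ (Fin d))) : Prop :=
  (⨆ (x ∈ X) (x' ∈ X) (_ : x ≠ x'), ‖x - x'‖ₑ) <
    ENNReal.ofReal Δ * ⨅ (x ∈ X) (x' ∈ X) (_ : x ≠ x'), ‖x - x'‖ₑ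

/-- Sigmoidal activation functions: both limits at `±∞` exist and they differ, and at some point
`z` the function is continuously differentiable (it is differentiable near `z` and its derivative is
continuous at `z`) with nonzero derivative. -/
def IsSigmoidal (σ : ℝ → ℝ) : Prop :=
  (∃ α β : ℝ, Tendsto σ atBot (𝓝 α) ∧ Tendsto σ atTop (𝓝 β) ∧ α ≠ β) ∧
  ∃ z : ℝ, (∀ᶠ x in 𝓝 z, DifferentiableAt ℝ σ x) ∧ ContinuousAt (deriv σ) z ∧ deriv σ z ≠ 0

/-- The weights and biases of an affine map `ℝ^m → ℝ^n`. -/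
structure AffineParams (m n : ℕ) where
  /-- the weights -/
  weight : Matrix (Fin n) (Fin m) ℝ
  /-- the biases -/
  bias : Fin n → ℝ

/-- The affine map `x ↦ W x + b`. -/
def AffineParams.apply {m n : ℕ} (t : AffineParams m n) (x : Fin m → ℝ) : Fin n → ℝ :=
  t.weight.mulVec x + t.bias

/-- The parameters `θ` of a fully connected feedforward network with input dimension `d`, hidden
layer dimensions given by the list (first hidden layer first), and output dimension `1`. -/
def NetParams : ℕ → List ℕ → Type
  | d, [] => AffineParams d 1
  | d, e :: ds => AffineParams d e × NetParams e ds

/-- The function `t_k ∘ σ ∘ ⋯ ∘ t_1 ∘ σ ∘ t_0` computed by the `σ` network with parameters `θ`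
(`k` is the number of hidden layers), where `σ` acts coordinatewise. -/
def netEval (σ : ℝ → ℝ) : (d : ℕ) → (ds : List ℕ) → NetParams d ds → (Fin d → ℝ) → ℝ
  | _, [], t, x => AffineParams.apply t x 0
  | _, e :: ds, θ, x => netEval σ e ds θ.2 (fun i => σ (θ.1.apply x i))

/-- The width of a network: the maximum of its hidden layer dimensions. -/
def netWidth (ds : List ℕ) : ℕ := ds.foldr max 0

/-- The `σ` network with input dimension `d` and hidden layer dimensions `ds` can memorize the pairs
`(x, y x)`, `x ∈ X`, with labels in `{0, …, C - 1}`: for every `ε > 0` some choice of the parameters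
fits all labels up to `ε`. -/
def CanMemorize (σ : ℝ → ℝ) {d C : ℕ} (ds : List ℕ) (X : Set (EuclideanSpace ℝ (Fin d)))
    (y : X → Fin C) : Prop :=
  ∀ ε : ℝ, 0 < ε → ∃ θ : NetParams d ds,
    ∀ x : X, |netEval σ d ds θ (fun i => x.1 i) - ((y x : ℕ) : ℝ)| ≤ ε

/-- The quantity `log d + log Δ + N^(2/3) log C`, with logarithms to the base `2`. -/
noncomputable def depthScale (C N d : ℕ) (Δ : ℝ) : ℝ :=
  Real.logb 2 d + Real.logb 2 Δ + (N : ℝ) ^ (2 / 3 : ℝ) * Real.logb 2 C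

/-!
A neuron `s ↦ α σ(β s + γ) + δ` approximates the identity (difference quotient at a point of nonzero
derivative) and every step function (limits at `±∞`). So networks may be replaced by limits of
networks, in which three coordinates can be used as position, code and scratch space, and one layer
can add constants to the first two coordinates on a set cut out by a half-space.

Some linear form with small integer coefficients, suitably scaled, sends the `N` points to reals at
distance at least `1` from each other, in a range of length polynomial in `d`, `Δ` and `N`. Cut this
range into consecutive blocks and translate each block by its own amount, one layer per block.
Choosing the translations so that the points stay separated folds the range: first, with two blocks
at a time, it is halved `O(log d + log Δ)` times until its length is `O(N ^ 2)`, then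
`O(N ^ (2 / 3))` further layers bring it down to `O(N ^ (4 / 3))`. Now there are `O(N ^ (2 / 3))`
blocks of `N ^ (2 / 3)` unit cells, each cell containing at most one point. One layer per block
moves all blocks to the same place and stores the labels of the block, as a single real number, in
the second coordinate. This code is read off cell by cell and bit by bit, three layers for each bit.
-/

section Networks

/-- The composition of two affine maps, on the level of weights and biases. -/
def AffineParams.comp {l m n : ℕ} (t : AffineParams m n) (s : AffineParams l m) :
    AffineParams l n :=
  ⟨t.weight * s.weight, t.weight.mulVec s.bias + t.bias⟩

theorem AffineParams.comp_apply {l m n : ℕ} (t : AffineParams m n) (s : AffineParams l m)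
    (x : Fin l → ℝ) : (t.comp s).apply x = t.apply (s.apply x) := by
  simp [AffineParams.comp, AffineParams.apply, Matrix.mulVec_add, add_assoc]

/-- The affine map `x ↦ (a i * x i + b i)ᵢ`, which acts on each coordinate separately. -/
def AffineParams.diagonal {n : ℕ} (a b : Fin n → ℝ) : AffineParams n n :=
  ⟨Matrix.diagonal a, b⟩

theorem AffineParams.diagonal_apply {n : ℕ} (a b x : Fin n → ℝ) :
    (AffineParams.diagonal a b).apply x = fun i => a i * x i + b i := by
  ext i
  simp [AffineParams.diagonal, AffineParams.apply, Matrix.mulVec_diagonal]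

/-- The coordinate function `x ↦ x i`, as an affine map with one output. -/
def AffineParams.proj {n : ℕ} (i : Fin n) : AffineParams n 1 :=
  ⟨Matrix.of fun _ => Pi.single i 1, 0⟩

theorem AffineParams.proj_apply {n : ℕ} (i : Fin n) (x : Fin n → ℝ) (j : Fin 1) :
    (AffineParams.proj i).apply x j = x i := by
  simp [AffineParams.proj, AffineParams.apply, Matrix.mulVec]

theorem AffineParams.continuous_apply {m n : ℕ} (t : AffineParams m n) : Continuous t.apply := by
  unfold AffineParams.apply
  fun_prop

theorem exists_netEval_comp (σ : ℝ → ℝ) {l m : ℕ} (t : AffineParams l m) (ds : List ℕ)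
    (θ : NetParams m ds) :
    ∃ θ' : NetParams l ds, ∀ x, netEval σ l ds θ' x = netEval σ m ds θ (t.apply x) := by
  cases ds with
  | nil => exact ⟨AffineParams.comp θ t, fun x => congrFun (AffineParams.comp_apply θ t x) 0⟩
  | cons e ds =>
    exact ⟨(AffineParams.comp θ.1 t, θ.2), fun x => by
      simp only [netEval, AffineParams.comp_apply]⟩

theorem exists_netEval_eq_zero (σ : ℝ → ℝ) (d : ℕ) (ds : List ℕ) :
    ∃ θ : NetParams d ds, ∀ x, netEval σ d ds θ x = 0 := by
  induction ds generalizing d with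
  | nil => exact ⟨(⟨0, 0⟩ : AffineParams d 1), fun x => by simp [netEval, AffineParams.apply]⟩
  | cons e ds ih =>
    obtain ⟨θ, hθ⟩ := ih e
    exact ⟨((⟨0, 0⟩ : AffineParams d e), θ), fun x => hθ _⟩

theorem netWidth_replicate {k : ℕ} (hk : k ≠ 0) (w : ℕ) : netWidth (List.replicate k w) = w := by
  induction k with
  | zero => contradiction
  | succ k ih =>
    rcases eq_or_ne k 0 with rfl | hk
    · simp [netWidth]
    · rw [List.replicate_succ]
      exact max_eq_left (ih hk).le

end Networks

section NetLimit

/-- The functions `X → ℝ^w` computed on the inputs `ξ x` by networks with `k` hidden layers and `w`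
outputs, all hidden layers having `w` neurons. -/
def layerOutputs (σ : ℝ → ℝ) {d w : ℕ} {X : Type*} (ξ : X → Fin d → ℝ) : ℕ → Set (X → Fin w → ℝ)
  | 0 => {U | ∃ t : AffineParams d w, U = fun x => t.apply (ξ x)}
  | k + 1 => {U | ∃ V ∈ layerOutputs σ ξ k, ∃ t : AffineParams w w,
      U = fun x => t.apply (fun i => σ (V x i))}

/-- `U : X → ℝ^w` is a pointwise limit of functions computed on the inputs `ξ x` by networks with
`k` hidden layers of `w` neurons each. -/
def NetLimit (σ : ℝ → ℝ) {d w : ℕ} {X : Type*} (ξ : X → Fin d → ℝ) (k : ℕ)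
    (U : X → Fin w → ℝ) : Prop :=
  U ∈ closure (layerOutputs σ ξ k)

variable {σ : ℝ → ℝ} {d w k : ℕ} {X : Type*} {ξ : X → Fin d → ℝ} {U V : X → Fin w → ℝ}

theorem affine_mem_layerOutputs (t : AffineParams w w) (hU : U ∈ layerOutputs σ ξ k) :
    (fun x => t.apply (U x)) ∈ layerOutputs σ ξ k := by
  cases k with
  | zero =>
    obtain ⟨s, rfl⟩ := hU
    exact ⟨t.comp s, by simp only [AffineParams.comp_apply]⟩
  | succ k =>
    obtain ⟨V, hV, s, rfl⟩ := hU
    exact ⟨V, hV, t.comp s, by simp only [AffineParams.comp_apply]⟩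

theorem exists_netEval_of_mem_layerOutputs (hU : U ∈ layerOutputs σ ξ k) (ds : List ℕ)
    (θ : NetParams w ds) :
    ∃ θ' : NetParams d (List.replicate k w ++ ds),
      ∀ x, netEval σ d _ θ' (ξ x) = netEval σ w ds θ (U x) := by
  induction k generalizing U ds with
  | zero =>
    obtain ⟨t, rfl⟩ := hU
    obtain ⟨θ', hθ'⟩ := exists_netEval_comp σ t ds θ
    exact ⟨θ', fun x => hθ' _⟩
  | succ k ih =>
    obtain ⟨V, hV, t, rfl⟩ := hU
    obtain ⟨θ₁, hθ₁⟩ := exists_netEval_comp σ t ds θ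
    rw [List.replicate_succ', List.append_assoc]
    obtain ⟨θ', hθ'⟩ := ih hV (w :: ds) (AffineParams.diagonal 1 0, θ₁)
    refine ⟨θ', fun x => (hθ' x).trans ?_⟩
    simp [← hθ₁, netEval, AffineParams.diagonal_apply]

theorem netLimit_zero (t : AffineParams d w) : NetLimit σ ξ 0 fun x => t.apply (ξ x) :=
  subset_closure ⟨t, rfl⟩

theorem NetLimit.affine (h : NetLimit σ ξ k U) (t : AffineParams w w) :
    NetLimit σ ξ k (fun x => t.apply (U x)) :=
  map_mem_closure (f := fun (U : X → Fin w → ℝ) x => t.apply (U x))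
    (continuous_pi fun x => t.continuous_apply.comp (continuous_apply x)) h
    fun _ => affine_mem_layerOutputs t

theorem NetLimit.exists_netEval [Finite X] (h : NetLimit σ ξ k U) (i : Fin w) {ε : ℝ}
    (hε : 0 < ε) :
    ∃ θ : NetParams d (List.replicate k w),
      ∀ x, |netEval σ d (List.replicate k w) θ (ξ x) - U x i| ≤ ε := by
  have hclose : ∀ᶠ V in 𝓝 U, ∀ x, |V x i - U x i| < ε :=
    eventually_all.2 fun x =>
      ((continuous_apply_apply x i).tendsto U).eventually (Metric.ball_mem_nhds _ hε)
  obtain ⟨V, hV, hVU⟩ := ((mem_closure_iff_frequently.1 h).and_eventually hclose).exists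
  obtain ⟨θ, hθ⟩ := exists_netEval_of_mem_layerOutputs hV [] (AffineParams.proj i)
  simp only [netEval, AffineParams.proj_apply] at hθ
  rw [← List.append_nil (List.replicate k w)]
  exact ⟨θ, fun x => by simpa only [hθ] using (hVU x).le⟩

end NetLimit

section Activation

/-- `σ` has distinct limits at `±∞` and, somewhere, a nonzero derivative: a weakening of
`IsSigmoidal` under which single neurons still approximate the identity and step functions. -/
structure IsWeaklySigmoidal (σ : ℝ → ℝ) : Prop where
  exists_limits : ∃ α β : ℝ, Tendsto σ atBot (𝓝 α) ∧ Tendsto σ atTop (𝓝 β) ∧ α ≠ β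
  exists_deriv_ne_zero : ∃ z, deriv σ z ≠ 0

variable {σ : ℝ → ℝ} {X : Type*} {u v : X → ℝ}

theorem IsSigmoidal.isWeaklySigmoidal (hσ : IsSigmoidal σ) : IsWeaklySigmoidal σ :=
  ⟨hσ.1, hσ.2.imp fun _ hz => hz.2.2⟩

/-- A sequence of functions `s ↦ α σ(β s + γ) + δ`, as computed by a single neuron, converges to
`v x` as `s → u x`. The convergence is jointly in the index and in `s`, so that it survives when `u`
itself is only computed in a limit. -/
def ActivationLimit (σ : ℝ → ℝ) {X : Type*} (u v : X → ℝ) : Prop :=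
  ∃ α β γ δ : ℕ → ℝ, ∀ x,
    Tendsto (fun q : ℕ × ℝ => α q.1 * σ (β q.1 * q.2 + γ q.1) + δ q.1) (atTop ×ˢ 𝓝 (u x))
      (𝓝 (v x))

theorem activationLimit_self_of_deriv_ne_zero {z : ℝ} (hz : deriv σ z ≠ 0) (u : X → ℝ) :
    ActivationLimit σ u u := by
  refine ⟨fun n => (n + 1) / deriv σ z, fun n => 1 / (n + 1), fun _ => z,
    fun n => -((n + 1) / deriv σ z * σ z), fun x => ?_⟩
  have hinv : Tendsto (fun q : ℕ × ℝ => 1 / ((q.1 : ℝ) + 1)) (atTop ×ˢ 𝓝 (u x)) (𝓝 0) :=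
    tendsto_one_div_add_atTop_nhds_zero_nat.comp tendsto_fst
  have hsnd : Tendsto (fun q : ℕ × ℝ => q.2) (atTop ×ˢ 𝓝 (u x)) (𝓝 (u x)) := tendsto_snd
  have hslope : Tendsto (fun q : ℕ × ℝ => dslope σ z (1 / ((q.1 : ℝ) + 1) * q.2 + z))
      (atTop ×ˢ 𝓝 (u x)) (𝓝 (deriv σ z)) := by
    rw [← dslope_same]
    refine (continuousAt_dslope_same.2 (differentiableAt_of_deriv_ne_zero hz)).tendsto.comp ?_
    simpa using (hinv.mul hsnd).add_const z
  have hlim := (hsnd.mul hslope).div_const (deriv σ z)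
  rw [mul_div_cancel_right₀ _ hz] at hlim
  refine hlim.congr fun q => ?_
  have hq : (q.1 : ℝ) + 1 ≠ 0 := by positivity
  have hdiff := sub_smul_dslope σ z (1 / ((q.1 : ℝ) + 1) * q.2 + z)
  rw [add_sub_cancel_right, smul_eq_mul] at hdiff
  calc q.2 * dslope σ z (1 / ((q.1 : ℝ) + 1) * q.2 + z) / deriv σ z
      = (q.1 + 1) / deriv σ z *
          (1 / ((q.1 : ℝ) + 1) * q.2 * dslope σ z (1 / ((q.1 : ℝ) + 1) * q.2 + z)) := by
        field_simp
    _ = _ := by rw [hdiff]; ring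

theorem activationLimit_indicator_lt {a b : ℝ} (ha : Tendsto σ atBot (𝓝 a))
    (hb : Tendsto σ atTop (𝓝 b)) (hab : a ≠ b) {c : ℝ} (hu : ∀ x, u x ≠ c) :
    ActivationLimit σ u ({x | c < u x}.indicator 1) := by
  have hba : b - a ≠ 0 := sub_ne_zero.2 hab.symm
  refine ⟨fun _ => (b - a)⁻¹, fun n => n, fun n => n * -c, fun _ => -((b - a)⁻¹ * a), fun x => ?_⟩
  have hfst : Tendsto (fun q : ℕ × ℝ => (q.1 : ℝ)) (atTop ×ˢ 𝓝 (u x)) atTop :=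
    tendsto_natCast_atTop_atTop.comp tendsto_fst
  have hsnd : Tendsto (fun q : ℕ × ℝ => q.2 + -c) (atTop ×ˢ 𝓝 (u x)) (𝓝 (u x - c)) :=
    tendsto_snd.add_const (-c)
  simp only [← mul_add]
  rcases (hu x).lt_or_gt with hlt | hgt
  · have hx : x ∉ {x | c < u x} := hlt.not_gt
    rw [Set.indicator_of_notMem hx,
      ← add_neg_cancel ((b - a)⁻¹ * a)]
    exact ((ha.comp (hfst.atTop_mul_neg (sub_neg.2 hlt) hsnd)).const_mul _).add_const _
  · have hx : x ∈ {x | c < u x} := hgt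
    rw [Set.indicator_of_mem hx, Pi.one_apply,
      show (1 : ℝ) = (b - a)⁻¹ * b + -((b - a)⁻¹ * a) by field_simp; ring]
    exact ((hb.comp (hfst.atTop_mul_pos (sub_pos.2 hgt) hsnd)).const_mul _).add_const _

theorem IsWeaklySigmoidal.activationLimit_self (hσ : IsWeaklySigmoidal σ) (u : X → ℝ) :
    ActivationLimit σ u u :=
  let ⟨_, hz⟩ := hσ.exists_deriv_ne_zero
  activationLimit_self_of_deriv_ne_zero hz u

theorem IsWeaklySigmoidal.activationLimit_indicator [Finite X] (hσ : IsWeaklySigmoidal σ)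
    {A : Set X} (hA : ∀ x ∈ A, ∀ x' ∉ A, u x' < u x) : ActivationLimit σ u (A.indicator 1) := by
  obtain ⟨a, b, ha, hb, hab⟩ := hσ.exists_limits
  obtain ⟨c, hlo, hhi⟩ : ∃ c, (∀ y ∈ u '' Aᶜ, y < c) ∧ ∀ y ∈ u '' A, c < y := by
    simpa using Order.exists_between_finsets (Aᶜ.toFinite.image u).toFinset
      (A.toFinite.image u).toFinset (by simpa using fun x' hx' x hx => hA x hx x' hx')
  rw [Set.forall_mem_image] at hlo hhi
  have hne : ∀ x, u x ≠ c := fun x => by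
    by_cases hx : x ∈ A
    exacts [(hhi hx).ne', (hlo hx).ne]
  have hAc : A = {x | c < u x} := Set.ext fun x =>
    ⟨fun hx => hhi hx, fun hx => by_contra fun hxA => hx.not_gt (hlo hxA)⟩
  rw [hAc]
  exact activationLimit_indicator_lt ha hb hab hne

variable {d w k : ℕ} {ξ : X → Fin d → ℝ} {U V : X → Fin w → ℝ}

theorem NetLimit.layer (h : NetLimit σ ξ k U)
    (hUV : ∀ i, ActivationLimit σ (fun x => U x i) fun x => V x i) : NetLimit σ ξ (k + 1) V := by
  choose α β γ δ hlim using hUV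
  have := mem_closure_iff_nhdsWithin_neBot.1 h
  refine mem_closure_of_tendsto (b := atTop ×ˢ 𝓝[layerOutputs σ ξ k] U)
    (f := fun q x i => α i q.1 * σ (β i q.1 * q.2 x i + γ i q.1) + δ i q.1) ?_ ?_
  · refine tendsto_pi_nhds.2 fun x => tendsto_pi_nhds.2 fun i => ?_
    have hcoord : Tendsto (fun q : ℕ × (X → Fin w → ℝ) => (q.1, q.2 x i))
        (atTop ×ˢ 𝓝[layerOutputs σ ξ k] U) (atTop ×ˢ 𝓝 (U x i)) :=
      tendsto_id.prodMap (((continuous_apply_apply x i).tendsto U).mono_left nhdsWithin_le_nhds)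
    exact (hlim i x).comp hcoord
  · filter_upwards [tendsto_snd.eventually self_mem_nhdsWithin] with q hq
    refine ⟨_, affine_mem_layerOutputs (.diagonal (β · q.1) (γ · q.1)) hq,
      .diagonal (α · q.1) (δ · q.1), ?_⟩
    simp only [AffineParams.diagonal_apply]

theorem NetLimit.mono (hσ : IsWeaklySigmoidal σ) {l : ℕ} (h : NetLimit σ ξ k U) (hkl : k ≤ l) :
    NetLimit σ ξ l U := by
  induction l, hkl using Nat.le_induction with
  | base => exact h
  | succ l _ ih => exact ih.layer fun i => hσ.activationLimit_self _

end Activation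

section Machine

variable {σ : ℝ → ℝ} {d k : ℕ} {X : Type*} {ξ : X → Fin d → ℝ} {u v w p : X → ℝ}

theorem exists_forall_lt_add [Finite X] (f : X → ℝ) : ∃ M, ∀ x x', f x' < f x + M := by
  obtain ⟨M, hM⟩ := (Set.finite_range fun q : X × X => f q.2 - f q.1).bddAbove
  exact ⟨M + 1, fun x x' => by linarith [hM ⟨(x, x'), rfl⟩]⟩

theorem NetLimit.affine₃ (h : NetLimit σ ξ k fun x => ![u x, v x, w x])
    (M : Matrix (Fin 3) (Fin 3) ℝ) (b : Fin 3 → ℝ) {u' v' w' : X → ℝ}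
    (hu : ∀ x, M 0 0 * u x + M 0 1 * v x + M 0 2 * w x + b 0 = u' x)
    (hv : ∀ x, M 1 0 * u x + M 1 1 * v x + M 1 2 * w x + b 1 = v' x)
    (hw : ∀ x, M 2 0 * u x + M 2 1 * v x + M 2 2 * w x + b 2 = w' x) :
    NetLimit σ ξ k fun x => ![u' x, v' x, w' x] := by
  convert h.affine ⟨M, b⟩ using 2 with x
  ext i
  fin_cases i <;>
    simp [AffineParams.apply, Matrix.mulVec, dotProduct, Fin.sum_univ_three, ← hu, ← hv, ← hw]

variable [Finite X]

theorem NetLimit.add_indicator (hσ : IsWeaklySigmoidal σ)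
    (h : NetLimit σ ξ k fun x => ![u x, v x, w x]) (a b c : ℝ) {A : Set X}
    (hA : ∀ x ∈ A, ∀ x' ∉ A, a * u x' + b * v x' + c * w x' < a * u x + b * v x + c * w x)
    (r s t : ℝ) :
    NetLimit σ ξ (k + 1) fun x =>
      ![u x + r * A.indicator 1 x, v x + s * A.indicator 1 x, t * A.indicator 1 x] := by
  have hform : NetLimit σ ξ k fun x => ![u x, v x, a * u x + b * v x + c * w x] :=
    h.affine₃ !![1, 0, 0; 0, 1, 0; a, b, c] 0 (by simp) (by simp) (by simp)
  have hlayer : NetLimit σ ξ (k + 1) fun x => ![u x, v x, A.indicator 1 x] := by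
    refine hform.layer fun i => ?_
    fin_cases i
    exacts [hσ.activationLimit_self u, hσ.activationLimit_self v, hσ.activationLimit_indicator hA]
  exact hlayer.affine₃ !![1, 0, r; 0, 1, s; 0, 0, t] 0 (by simp) (by simp) (by simp)

theorem NetLimit.add_comp (hσ : IsWeaklySigmoidal σ)
    (h : NetLimit σ ξ k fun x => ![u x, v x, w x]) (κ : X → ℕ) (G E : ℕ → ℝ)
    (hG : ∀ x x' i, κ x ≤ i → i < κ x' → u x + G (κ x) < u x' + G i) {m : ℕ}
    (hm : ∀ x, κ x ≤ m) :
    NetLimit σ ξ (k + m) fun x => ![u x + G (κ x), v x + E (κ x), 0] := by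
  -- The layers raise the block number from `0` to `κ x` one unit at a time.
  suffices hmin : ∀ i, NetLimit σ ξ (k + i)
      fun x => ![u x + G (min (κ x) i), v x + E (min (κ x) i), 0] by
    simpa only [min_eq_left (hm _)] using hmin m
  intro i
  induction i with
  | zero =>
    exact h.affine₃ !![1, 0, 0; 0, 1, 0; 0, 0, 0] ![G 0, E 0, 0] (by simp) (by simp) (by simp)
  | succ i ih =>
    have hmin_succ (F : ℕ → ℝ) (x : X) : F (min (κ x) i) +
        (F (i + 1) - F i) * {x | i < κ x}.indicator 1 x = F (min (κ x) (i + 1)) := by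
      rcases lt_or_ge i (κ x) with hx | hx
      · rw [Set.indicator_of_mem (show x ∈ {x | i < κ x} from hx), min_eq_right hx.le,
          min_eq_right (Nat.succ_le_of_lt hx), Pi.one_apply]
        ring
      · rw [Set.indicator_of_notMem (show x ∉ {x | i < κ x} from hx.not_gt), min_eq_left hx,
          min_eq_left (hx.trans i.le_succ), mul_zero, add_zero]
    have hstep := ih.add_indicator hσ 1 0 0 (A := {x | i < κ x}) (fun x hx x' hx' => by
      have hx : i < κ x := hx
      have hx' : κ x' ≤ i := not_lt.1 hx'
      simpa [min_eq_right hx.le, min_eq_left hx'] using hG x' x i hx' hx)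
      (G (i + 1) - G i) (E (i + 1) - E i) 0
    simpa only [add_assoc, hmin_succ, zero_mul] using hstep

theorem NetLimit.indicator_inter {A H : Set X} (hσ : IsWeaklySigmoidal σ)
    (h : NetLimit σ ξ k fun x => ![p x, v x, A.indicator 1 x]) (c : ℝ)
    (hH : ∀ x ∈ H, ∀ x' ∉ H, c * p x' < c * p x) (s t : ℝ) :
    NetLimit σ ξ (k + 1) fun x =>
      ![p x, v x + s * (A ∩ H).indicator 1 x, t * (A ∩ H).indicator 1 x] := by
  obtain ⟨M, hM⟩ := exists_forall_lt_add fun x => c * p x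
  convert h.add_indicator hσ c 0 M (A := A ∩ H) ?_ 0 s t using 3
  · simp
  · rintro x ⟨hxA, hxH⟩ x' hx'
    by_cases hx'A : x' ∈ A
    · have hx'H : x' ∉ H := fun hx'H => hx' ⟨hx'A, hx'H⟩
      simpa [hxA, hx'A] using hH x hxH x' hx'H
    · simpa [hxA, hx'A] using hM x x'

theorem NetLimit.add_cell {A : Set X} {Λ : ℝ} (hσ : IsWeaklySigmoidal σ)
    (h : NetLimit σ ξ k fun x => ![p x, v x + Λ * A.indicator 1 x, 0])
    (hΛ : ∀ x x', v x' < v x + Λ) (l r t : ℝ) :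
    NetLimit σ ξ (k + 3) fun x =>
      ![p x, v x + t * (A ∩ p ⁻¹' Set.Ico l r).indicator 1 x, 0] := by
  have hA : NetLimit σ ξ (k + 1) fun x => ![p x, v x, A.indicator 1 x] := by
    convert h.add_indicator hσ 0 1 0 (A := A) ?_ 0 (-Λ) 1 using 2 with x
    · simp
    · intro x hx x' hx'
      simpa [hx, hx'] using hΛ x x'
  have hl : NetLimit σ ξ (k + 2) fun x => ![p x, v x, (A ∩ p ⁻¹' Set.Ici l).indicator 1 x] := by
    simpa using hA.indicator_inter hσ (H := p ⁻¹' Set.Ici l) 1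
      (fun x hx x' hx' => by simpa using (not_le.1 hx').trans_le hx) 0 1
  have hr := hl.indicator_inter hσ (H := p ⁻¹' Set.Iio r) (-1)
    (fun x hx x' hx' => by simpa using hx.trans_le (not_lt.1 hx')) t 0
  simpa only [Set.inter_assoc, ← Set.preimage_inter, Set.Ici_inter_Iio, zero_mul] using hr

theorem exists_code_sum_indicator (hσ : IsWeaklySigmoidal σ) {β ι : Type*} (κ : X → β) (p : X → ℝ)
    (l r weight : ι → ℝ) (S : ι → Set β) (s : Finset ι) (acc : X → ℝ) :
    ∃ e : β → ℝ, ∀ k, NetLimit σ ξ k (fun x => ![p x, acc x + e (κ x), 0]) →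
      NetLimit σ ξ (k + 3 * s.card) fun x => ![p x, acc x +
        ∑ i ∈ s, weight i * (κ ⁻¹' S i ∩ p ⁻¹' Set.Ico (l i) (r i)).indicator 1 x, 0] := by
  classical
  induction s using Finset.induction_on generalizing acc with
  | empty => exact ⟨0, fun k h => by simpa using h⟩
  | insert i s hi ih =>
    obtain ⟨e, he⟩ := ih fun x =>
      acc x + weight i * (κ ⁻¹' S i ∩ p ⁻¹' Set.Ico (l i) (r i)).indicator 1 x
    obtain ⟨Λ, hΛ⟩ := exists_forall_lt_add fun x => acc x + e (κ x)
    -- The rest of the code varies by less than `Λ`, so a threshold detects the summand `Λ`.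
    refine ⟨fun b => e b + Λ * (S i).indicator 1 b, fun k h => ?_⟩
    simp only [← add_assoc] at h
    have hcell := NetLimit.add_cell (A := κ ⁻¹' S i) hσ h hΛ (l i) (r i) (weight i)
    have hrest := he (k + 3) (by simpa only [add_right_comm] using hcell)
    rw [Finset.card_insert_of_notMem hi, mul_add, mul_one, add_comm (3 * s.card), ← add_assoc]
    simpa only [Finset.sum_insert hi, ← add_assoc] using hrest

theorem sum_bitIndices {B y : ℕ} (hy : y < 2 ^ B) :
    ∑ t ∈ Finset.range B, (if t ∈ y.bitIndices then 2 ^ t else 0) = y := by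
  have hsub : y.bitIndices.toFinset ⊆ Finset.range B := fun t ht => Finset.mem_range.2 <|
    (Nat.pow_lt_pow_iff_right one_lt_two).1 <|
      (Nat.two_pow_le_of_mem_bitIndices (List.mem_toFinset.1 ht)).trans_lt hy
  rw [← Finset.sum_filter]
  conv_rhs => rw [← Finset.sum_toFinset_bitIndices_two_pow y]
  congr 1
  ext t
  simpa using fun ht => Finset.mem_range.1 (hsub (List.mem_toFinset.2 ht))

theorem exists_label_code (hσ : IsWeaklySigmoidal σ) {β : Type*} (κ : X → β) {y : X → ℕ}
    {n B : ℕ} (hp : ∀ x, p x ∈ Set.Ico 0 (n : ℝ)) (hy : ∀ x, y x < 2 ^ B)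
    (hfac : y.FactorsThrough fun x => (κ x, ⌊p x⌋₊)) :
    ∃ e : β → ℝ, ∀ k, NetLimit σ ξ k (fun x => ![p x, e (κ x), 0]) →
      NetLimit σ ξ (k + 3 * (n * B)) fun x => ![p x, y x, 0] := by
  let S : ℕ × ℕ → Set β := fun q => {b | ∃ x, κ x = b ∧ ⌊p x⌋₊ = q.1 ∧ q.2 ∈ (y x).bitIndices}
  obtain ⟨e, he⟩ := exists_code_sum_indicator (ξ := ξ) hσ κ p (fun q => q.1) (fun q => q.1 + 1)
    (fun q => 2 ^ q.2) S (Finset.range n ×ˢ Finset.range B) 0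
  refine ⟨e, fun k h => ?_⟩
  have hcell (x : X) (j t : ℕ) : x ∈ κ ⁻¹' S (j, t) ∩ p ⁻¹' Set.Ico (j : ℝ) (j + 1) ↔
      ⌊p x⌋₊ = j ∧ t ∈ (y x).bitIndices := by
    rw [Set.mem_inter_iff, Set.mem_preimage (f := p), Set.mem_Ico, ← Nat.floor_eq_iff (hp x).1]
    constructor
    · rintro ⟨⟨x', hκ, hj', ht⟩, hj⟩
      exact ⟨hj, hfac (Prod.ext hκ (hj'.trans hj.symm)) ▸ ht⟩
    · rintro ⟨hj, ht⟩
      exact ⟨⟨x, rfl, hj, ht⟩, hj⟩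
  have hfloor (x : X) : ⌊p x⌋₊ ∈ Finset.range n :=
    Finset.mem_range.2 ((Nat.floor_lt (hp x).1).2 (hp x).2)
  have hsum (x : X) : ∑ q ∈ Finset.range n ×ˢ Finset.range B,
      (2 : ℝ) ^ q.2 * (κ ⁻¹' S q ∩ p ⁻¹' Set.Ico (q.1 : ℝ) (q.1 + 1)).indicator 1 x = y x := by
    classical
    simp only [Finset.sum_product, Set.indicator_apply, hcell, Pi.one_apply, mul_ite, mul_one,
      mul_zero, ite_and, Finset.sum_ite_irrel, Finset.sum_const_zero, Finset.sum_ite_eq,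
      if_pos (hfloor x)]
    exact_mod_cast sum_bitIndices (hy x)
  simpa only [Finset.card_product, Finset.card_range, hsum, Pi.zero_apply, zero_add] using
    he k (by simpa using h)

end Machine

section Projection

variable {ι : Type*} [Fintype ι]

theorem eq_of_two_mul_abs_sum_lt {w : ι → ℝ} {u u' : ι → ℕ} {j : ι}
    (huu' : ∀ i, i ≠ j → u i = u' i) (hu : 2 * |∑ i, u i * w i| < |w j|)
    (hu' : 2 * |∑ i, u' i * w i| < |w j|) : u = u' := by
  have hdiff : ∑ i, u i * w i - ∑ i, u' i * w i = (u j - u' j : ℝ) * w j := by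
    rw [← Finset.sum_sub_distrib, Finset.sum_eq_single j, sub_mul]
    · intro i _ hij
      rw [huu' i hij, sub_self]
    · simp
  have hlt : |(u j - u' j : ℝ)| * |w j| < 1 * |w j| := by
    rw [← abs_mul, ← hdiff]
    refine (abs_sub _ _).trans_lt ?_
    linarith
  have hj : |(u j : ℤ) - u' j| < 1 := by exact_mod_cast lt_of_mul_lt_mul_right hlt (abs_nonneg _)
  funext i
  by_cases hij : i = j
  · rw [hij]
    exact_mod_cast sub_eq_zero.1 (Int.abs_lt_one_iff.1 hj)
  · exact huu' i hij

theorem card_filter_two_mul_abs_sum_lt_mul_le [DecidableEq ι] (M : ℕ) (w : ι → ℝ) :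
    (Finset.univ.filter fun u : ι → Fin M => 2 * |∑ i, (u i : ℕ) * w i| < ‖w‖).card * M ≤
      M ^ Fintype.card ι := by
  rcases isEmpty_or_nonempty ι with _ | _
  · simp [Subsingleton.elim w 0]
  obtain ⟨j, hj⟩ := Finite.exists_max fun i => ‖w i‖
  have hwj : ‖w‖ ≤ |w j| := (pi_norm_le_iff_of_nonneg (norm_nonneg _)).2 hj
  calc _ = (Finset.univ.filter (fun u : ι → Fin M => 2 * |∑ i, (u i : ℕ) * w i| < ‖w‖) ×ˢ
        (Finset.univ : Finset (Fin M))).card := by simp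
    _ ≤ (Finset.univ : Finset (ι → Fin M)).card := by
      refine Finset.card_le_card_of_injOn (fun q => Function.update q.1 j q.2)
        (fun _ _ => Finset.mem_coe.2 (Finset.mem_univ _)) ?_
      rintro ⟨u, s⟩ hu ⟨u', s'⟩ hu' heq
      simp only [Finset.coe_product, Finset.coe_filter, Set.mem_prod, Set.mem_ofPred_eq,
        Finset.mem_univ, true_and, Finset.coe_univ, Set.mem_univ, and_true] at hu hu'
      have huu' (i : ι) (hi : i ≠ j) : (u i : ℕ) = u' i := by
        simpa [hi] using congrArg Fin.val (congrFun heq i)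
      have := eq_of_two_mul_abs_sum_lt huu' (hu.trans_le hwj) (hu'.trans_le hwj)
      exact Prod.ext (funext fun i => Fin.ext (congrFun this i)) (by simpa using congrFun heq j)
    _ = M ^ Fintype.card ι := by simp

theorem exists_norm_le_two_mul_abs_sum {M : ℕ} {P : Finset (ι → ℝ)} (hP : P.card < M) :
    ∃ u : ι → Fin M, ∀ w ∈ P, ‖w‖ ≤ 2 * |∑ i, (u i : ℕ) * w i| := by
  classical
  let bad : (ι → ℝ) → Finset (ι → Fin M) := fun w =>
    Finset.univ.filter fun u => 2 * |∑ i, (u i : ℕ) * w i| < ‖w‖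
  have hM : 0 < M := P.card.zero_le.trans_lt hP
  have hcard : (P.biUnion bad).card < (Finset.univ : Finset (ι → Fin M)).card := by
    refine lt_of_mul_lt_mul_right (a := M) ?_ M.zero_le
    calc (P.biUnion bad).card * M ≤ (∑ w ∈ P, (bad w).card) * M := by
          gcongr
          exact Finset.card_biUnion_le
      _ = ∑ w ∈ P, (bad w).card * M := Finset.sum_mul _ _ _
      _ ≤ ∑ _ ∈ P, M ^ Fintype.card ι :=
          Finset.sum_le_sum fun w _ => card_filter_two_mul_abs_sum_lt_mul_le M w
      _ = P.card * M ^ Fintype.card ι := by simp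
      _ < M * M ^ Fintype.card ι := by gcongr
      _ = (Finset.univ : Finset (ι → Fin M)).card * M := by simp [mul_comm]
  obtain ⟨u, -, hu⟩ := Finset.exists_mem_notMem_of_card_lt_card hcard
  exact ⟨u, fun w hw => not_lt.1 fun hlt =>
    hu (Finset.mem_biUnion.2 ⟨w, hw, Finset.mem_filter.2 ⟨Finset.mem_univ u, hlt⟩⟩)⟩

theorem norm_le_card_mul_norm_ofLp (x : EuclideanSpace ℝ ι) :
    ‖x‖ ≤ Fintype.card ι * ‖(x.ofLp : ι → ℝ)‖ := by
  have hsum : ‖x‖ ≤ ∑ i, ‖x i‖ := by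
    refine le_of_sq_le_sq ?_ (by positivity)
    rw [EuclideanSpace.norm_sq_eq]
    exact Finset.sum_sq_le_sq_sum_of_nonneg fun i _ => norm_nonneg _
  refine hsum.trans ((Finset.sum_le_card_nsmul _ _ _ fun i _ => norm_le_pi_norm x.ofLp i).trans ?_)
  simp

theorem exists_dist_le_abs_sum {X : Type*} [Fintype X] [Nonempty X]
    (ξ : X → EuclideanSpace ℝ ι) :
    ∃ u : ι → Fin (Fintype.card X ^ 2), ∀ x x',
      ‖ξ x - ξ x'‖ ≤ 2 * Fintype.card ι * |∑ i, (u i : ℕ) * (ξ x i - ξ x' i)| := by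
  classical
  let P : Finset (ι → ℝ) := Finset.univ.offDiag.image fun q : X × X => (ξ q.1 - ξ q.2).ofLp
  have hP : P.card < Fintype.card X ^ 2 := by
    refine Finset.card_image_le.trans_lt ?_
    rw [Finset.offDiag_card, Finset.card_univ, sq]
    exact Nat.sub_lt (by positivity) Fintype.card_pos
  obtain ⟨u, hu⟩ := exists_norm_le_two_mul_abs_sum hP
  refine ⟨u, fun x x' => ?_⟩
  rcases eq_or_ne x x' with rfl | hne
  · simp
  · have hmem : (ξ x - ξ x').ofLp ∈ P := Finset.mem_image.2 ⟨(x, x'), by simpa using hne, rfl⟩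
    calc ‖ξ x - ξ x'‖ ≤ Fintype.card ι * ‖(ξ x - ξ x').ofLp‖ := norm_le_card_mul_norm_ofLp _
      _ ≤ Fintype.card ι * (2 * |∑ i, (u i : ℕ) * (ξ x - ξ x').ofLp i|) := by
        gcongr
        exact hu _ hmem
      _ = _ := by
        rw [← mul_assoc, mul_comm (Fintype.card ι : ℝ)]
        rfl

/-- The values of `f` are nonnegative and have mutual distances at least `1`: the normal form in
which the network carries the points of the data set. -/
structure Spread {X : Type*} (f : X → ℝ) : Prop where
  nonneg : ∀ x, 0 ≤ f x
  one_le_abs_sub : ∀ x x', x ≠ x' → 1 ≤ |f x - f x'|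

theorem Spread.injective {X : Type*} {f : X → ℝ} (hf : Spread f) : f.Injective := by
  intro x x' h
  by_contra hne
  have := hf.one_le_abs_sub x x' hne
  norm_num [h] at this

variable {d : ℕ} {Δ : ℝ} {X : Set (EuclideanSpace ℝ (Fin d))}

theorem IsDeltaSeparated.pos (hX : IsDeltaSeparated Δ X) : 0 < Δ := by
  by_contra! hΔ
  rw [IsDeltaSeparated, ENNReal.ofReal_of_nonpos hΔ, zero_mul] at hX
  exact not_lt_bot hX

theorem IsDeltaSeparated.exists_bounds (hX : IsDeltaSeparated Δ X) :
    ∃ δ : ℝ, 0 < δ ∧ ∀ x ∈ X, ∀ x' ∈ X, x ≠ x' → δ ≤ ‖x - x'‖ ∧ ‖x - x'‖ ≤ Δ * δ := by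
  by_cases hsub : X.Subsingleton
  · exact ⟨1, one_pos, fun x hx x' hx' hne => absurd (hsub hx hx') hne⟩
  have hΔ := hX.pos
  unfold IsDeltaSeparated at hX
  set I := ⨅ (x ∈ X) (x' ∈ X) (_ : x ≠ x'), ‖x - x'‖ₑ
  have hinf : ∀ x ∈ X, ∀ x' ∈ X, x ≠ x' → I ≤ ‖x - x'‖ₑ := fun x hx x' hx' hne =>
    iInf₂_le_of_le x hx (iInf₂_le_of_le x' hx' (iInf_le_of_le hne le_rfl))
  have hsup : ∀ x ∈ X, ∀ x' ∈ X, x ≠ x' → ‖x - x'‖ₑ ≤ ENNReal.ofReal Δ * I :=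
    fun x hx x' hx' hne =>
      (le_iSup₂_of_le x hx <| le_iSup₂_of_le x' hx' <|
        le_iSup (fun _ : x ≠ x' => ‖x - x'‖ₑ) hne).trans hX.le
  have hpos : I ≠ 0 := fun hI => not_lt_bot (hX.trans_eq (by rw [hI, mul_zero]; rfl))
  have htop : I ≠ ⊤ := by
    obtain ⟨x, hx, x', hx', hne⟩ := Set.not_subsingleton_iff.1 hsub
    exact ((hinf x hx x' hx' hne).trans_lt enorm_lt_top).ne
  refine ⟨I.toReal, ENNReal.toReal_pos hpos htop, fun x hx x' hx' hne => ⟨?_, ?_⟩⟩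
  · simpa using ENNReal.toReal_mono enorm_ne_top (hinf x hx x' hx' hne)
  · simpa [hΔ.le] using ENNReal.toReal_mono (ENNReal.mul_ne_top ENNReal.ofReal_ne_top htop)
      (hsup x hx x' hx' hne)

theorem IsDeltaSeparated.exists_projection [Fintype X] [Nonempty X]
    (hX : IsDeltaSeparated Δ X) :
    ∃ (a : Fin d → ℝ) (b : ℝ) (f : X → ℝ), (∀ x, f x = ∑ i, a i * x.1 i + b) ∧ Spread f ∧
      ∀ x, f x ≤ 2 * (Fintype.card X : ℝ) ^ 2 * d ^ 2 * Δ := by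
  obtain ⟨δ, hδ, hbounds⟩ := hX.exists_bounds
  have hΔ := hX.pos
  obtain ⟨u, hu⟩ := exists_dist_le_abs_sum ((↑) : X → EuclideanSpace ℝ (Fin d))
  rw [Fintype.card_fin] at hu
  let F : X → ℝ := fun x => ∑ i, 2 * d / δ * (u i : ℕ) * x.1 i
  have hF (x x' : X) : F x - F x' = 2 * d / δ * ∑ i, (u i : ℕ) * (x.1 i - x'.1 i) := by
    simp only [F, ← Finset.sum_sub_distrib, Finset.mul_sum, ← mul_sub, mul_assoc]
  have hlower (x x' : X) (hne : x ≠ x') : 1 ≤ |F x - F x'| := by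
    rw [hF, abs_mul, abs_of_nonneg (by positivity : 0 ≤ 2 * d / δ), div_mul_eq_mul_div,
      one_le_div hδ]
    exact (hbounds x x.2 x' x'.2 (Subtype.coe_injective.ne hne)).1.trans (hu x x')
  have hcoord (x x' : X) (i : Fin d) : |x.1 i - x'.1 i| ≤ Δ * δ := by
    rcases eq_or_ne x x' with rfl | hne
    · simpa using (mul_pos hΔ hδ).le
    · exact (PiLp.norm_apply_le (x.1 - x'.1) i).trans
        (hbounds x x.2 x' x'.2 (Subtype.coe_injective.ne hne)).2
  have hupper (x x' : X) : F x - F x' ≤ 2 * (Fintype.card X : ℝ) ^ 2 * d ^ 2 * Δ := by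
    have hterm (i : Fin d) :
        (u i : ℕ) * (x.1 i - x'.1 i) ≤ (Fintype.card X : ℝ) ^ 2 * (Δ * δ) := by
      calc _ ≤ (u i : ℕ) * (Δ * δ) := by
            gcongr
            exact (le_abs_self _).trans (hcoord x x' i)
        _ ≤ _ := by
            gcongr
            exact_mod_cast (u i).2.le
    rw [hF]
    calc _ ≤ 2 * d / δ * ∑ _ : Fin d, (Fintype.card X : ℝ) ^ 2 * (Δ * δ) :=
          mul_le_mul_of_nonneg_left (Finset.sum_le_sum fun i _ => hterm i) (by positivity)
      _ = _ := by
          rw [Finset.sum_const, Finset.card_univ, Fintype.card_fin, nsmul_eq_mul]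
          field_simp
  obtain ⟨x₀, hx₀⟩ := Finite.exists_min F
  refine ⟨fun i => 2 * d / δ * (u i : ℕ), -F x₀, fun x => F x - F x₀, fun x => rfl,
    ⟨fun x => sub_nonneg.2 (hx₀ x), ?_⟩, (hupper · x₀)⟩
  simpa only [sub_sub_sub_cancel_right] using hlower

end Projection

section Folding

theorem exists_shift (A B : Finset ℝ) :
    ∃ s ≤ A.card * B.card, ∀ a ∈ A, ∀ b ∈ B, 1 ≤ |a + 2 * (s : ℕ) - b| := by
  let bad : ℝ × ℝ → Finset ℕ := fun q =>
    (Finset.range (A.card * B.card + 1)).filter fun s => |q.1 + 2 * (s : ℕ) - q.2| < 1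
  have hbad (q : ℝ × ℝ) : (bad q).card ≤ 1 := by
    refine Finset.card_le_one.2 fun s hs s' hs' => ?_
    have hs := abs_lt.1 (Finset.mem_filter.1 hs).2
    have hs' := abs_lt.1 (Finset.mem_filter.1 hs').2
    have hlt : (s : ℝ) < s' + 1 := by linarith
    have hlt' : (s' : ℝ) < s + 1 := by linarith
    norm_cast at hlt hlt'
    omega
  have hcard : ((A ×ˢ B).biUnion bad).card < (Finset.range (A.card * B.card + 1)).card := by
    refine (Finset.card_biUnion_le_card_mul _ _ 1 fun q _ => hbad q).trans_lt ?_
    simp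
  obtain ⟨s, hs, hgood⟩ := Finset.exists_mem_notMem_of_card_lt_card hcard
  refine ⟨s, Finset.mem_range_succ_iff.1 hs, fun a ha b hb => not_lt.1 fun hlt => hgood ?_⟩
  exact Finset.mem_biUnion.2 ⟨(a, b), Finset.mk_mem_product ha hb, Finset.mem_filter.2 ⟨hs, hlt⟩⟩

variable {X : Type*} [Fintype X]

theorem exists_separating_shift (r : X → ℝ) (κ : X → ℕ) {n : ℕ}
    (hn : ∀ i, (Finset.univ.filter fun x => κ x = i).card ≤ n)
    (hr : ∀ x x', κ x = κ x' → x ≠ x' → 1 ≤ |r x - r x'|) :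
    ∃ t : ℕ → ℕ, (∀ i, t i ≤ n * Fintype.card X) ∧
      ∀ x x', x ≠ x' → 1 ≤ |r x + 2 * t (κ x) - (r x' + 2 * t (κ x'))| := by
  classical
  have hblocks (m : ℕ) : ∃ t : ℕ → ℕ, (∀ i, t i ≤ n * Fintype.card X) ∧
      ∀ x x', κ x' < κ x → κ x < m → 1 ≤ |r x + 2 * t (κ x) - (r x' + 2 * t (κ x'))| := by
    induction m with
    | zero => exact ⟨0, by simp, by simp⟩
    | succ m ih =>
      obtain ⟨t, ht, hsep⟩ := ih
      obtain ⟨s, hs, hgood⟩ := exists_shift ((Finset.univ.filter fun x => κ x = m).image r)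
        (Finset.univ.image fun x => r x + 2 * t (κ x))
      refine ⟨Function.update t m s, fun i => ?_, fun x x' hlt hx => ?_⟩
      · rcases eq_or_ne i m with rfl | hi
        · rw [Function.update_self]
          exact hs.trans (Nat.mul_le_mul (Finset.card_image_le.trans (hn i)) Finset.card_image_le)
        · rw [Function.update_of_ne hi]
          exact ht i
      · have hx' : κ x' ≠ m := by omega
        rcases eq_or_ne (κ x) m with hxm | hxm
        · rw [hxm, Function.update_self, Function.update_of_ne hx']
          exact hgood _ (Finset.mem_image_of_mem r (by simpa using hxm)) _
            (Finset.mem_image_of_mem _ (Finset.mem_univ x'))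
        · rw [Function.update_of_ne hxm, Function.update_of_ne hx']
          exact hsep x x' hlt (by omega)
  obtain ⟨m, hm⟩ := (Set.finite_range κ).bddAbove
  obtain ⟨t, ht, hsep⟩ := hblocks (m + 1)
  have hκ (x : X) : κ x < m + 1 := Nat.lt_succ_of_le (hm ⟨x, rfl⟩)
  refine ⟨t, ht, fun x x' hne => ?_⟩
  rcases lt_trichotomy (κ x) (κ x') with hlt | heq | hlt
  · rw [abs_sub_comm]
    exact hsep x' x hlt (hκ x')
  · simpa [heq] using hr x x' heq hne
  · exact hsep x x' hlt (hκ x)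

theorem exists_rank {f : X → ℝ} (hf : f.Injective) :
    ∃ rank : X → Fin (Fintype.card X), ∀ x x', rank x ≤ rank x' ↔ f x ≤ f x' := by
  let _ := LinearOrder.lift' f hf
  exact ⟨(Fintype.orderIsoFinOfCardEq X rfl).symm, fun x x' => OrderIso.le_iff_le _⟩

theorem exists_blocks {f : X → ℝ} (hf : f.Injective) {L : ℝ} (hL : 0 ≤ L) {n : ℕ} (hn : 0 < n) :
    ∃ κ : X → ℕ, (∀ x x', κ x < κ x' → f x < f x') ∧
      (∀ i, (Finset.univ.filter fun x => κ x = i).card ≤ n) ∧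
      (∀ x, κ x ≤ (Fintype.card X - 1) / n + ⌊f x / L⌋₊) ∧
      Function.FactorsThrough (fun x => ⌊f x / L⌋₊) κ := by
  classical
  obtain ⟨rank, hrank⟩ := exists_rank hf
  have hdiv {x x' : X} (h : f x ≤ f x') : (rank x : ℕ) / n ≤ rank x' / n :=
    Nat.div_le_div_right ((hrank x x').2 h)
  have hfloor {x x' : X} (h : f x ≤ f x') : ⌊f x / L⌋₊ ≤ ⌊f x' / L⌋₊ :=
    Nat.floor_mono (div_le_div_of_nonneg_right h hL)
  let κ : X → ℕ := fun x => rank x / n + ⌊f x / L⌋₊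
  have hκ (x x' : X) (h : κ x = κ x') :
      (rank x : ℕ) / n = rank x' / n ∧ ⌊f x / L⌋₊ = ⌊f x' / L⌋₊ := by
    simp only [κ] at h
    rcases le_total (f x) (f x') with hle | hle <;> have := hdiv hle <;> have := hfloor hle <;>
      omega
  refine ⟨κ, fun x x' h => ?_, fun i => ?_, fun x => ?_, fun x x' h => (hκ x x' h).2⟩
  · contrapose! h
    exact add_le_add (hdiv h) (hfloor h)
  · rcases (Finset.univ.filter fun x => κ x = i).eq_empty_or_nonempty with hempty | ⟨x₀, hx₀⟩
    · simp [hempty]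
    have hrank_inj : (fun x => (rank x : ℕ)).Injective := fun x x' h =>
      hf (le_antisymm ((hrank x x').1 h.le) ((hrank x' x).1 h.ge))
    have hmaps : ∀ x ∈ Finset.univ.filter fun x => κ x = i,
        (rank x : ℕ) ∈ Finset.Ico (n * (rank x₀ / n)) (n * (rank x₀ / n) + n) := by
      intro x hx
      rw [← (hκ x x₀ ((Finset.mem_filter.1 hx).2.trans (Finset.mem_filter.1 hx₀).2.symm)).1]
      exact Finset.mem_Ico.2 ⟨Nat.mul_div_le _ _, Nat.lt_mul_div_succ _ hn⟩
    simpa using Finset.card_le_card_of_injOn _ hmaps hrank_inj.injOn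
  · exact Nat.add_le_add_right (Nat.div_le_div_right (Nat.le_sub_one_of_lt (rank x).2)) _

theorem sub_mul_floor_mem_Ico {a L : ℝ} (ha : 0 ≤ a) (hL : 0 < L) :
    a - L * ⌊a / L⌋₊ ∈ Set.Ico 0 L := by
  have hle := (le_div_iff₀' hL).1 (Nat.floor_le (div_nonneg ha hL.le))
  have hlt := (div_lt_iff₀' hL).1 (Nat.lt_floor_add_one (a / L))
  exact ⟨by linarith, by linarith⟩

theorem Spread.exists_fold {f : X → ℝ} (hf : Spread f) {L : ℝ} (hL : 0 < L) {n : ℕ}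
    (hn : 0 < n) :
    ∃ (κ : X → ℕ) (E : ℕ → ℝ), (∀ x x', κ x < κ x' → f x < f x') ∧
      (∀ x, κ x ≤ (Fintype.card X - 1) / n + ⌊f x / L⌋₊) ∧
      Spread (fun x => f x + E (κ x)) ∧ ∀ x, f x + E (κ x) < L + 2 * n * Fintype.card X := by
  obtain ⟨κ, hmono, hcard, hκ, hfac⟩ := exists_blocks hf.injective hL.le hn
  obtain ⟨c, hc⟩ := (Function.factorsThrough_iff _).1 hfac
  have hmem (x : X) : f x - L * c (κ x) ∈ Set.Ico 0 L := by
    rw [← Function.comp_apply (f := c), ← hc]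
    exact sub_mul_floor_mem_Ico (hf.nonneg x) hL
  obtain ⟨t, ht, hsep⟩ := exists_separating_shift (fun x => f x - L * c (κ x)) κ hcard
    fun x x' h hne => by simpa [h] using hf.one_le_abs_sub x x' hne
  have hE (x : X) : f x + (2 * t (κ x) - L * c (κ x)) = f x - L * c (κ x) + 2 * t (κ x) := by ring
  refine ⟨κ, fun i => 2 * t i - L * c i, hmono, hκ, ⟨fun x => ?_, fun x x' hne => ?_⟩,
    fun x => ?_⟩
  · rw [hE]
    exact add_nonneg (hmem x).1 (by positivity)
  · rw [hE, hE]
    exact hsep x x' hne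
  · have : (t (κ x) : ℝ) ≤ n * Fintype.card X := by exact_mod_cast ht (κ x)
    rw [hE]
    linarith [(hmem x).2]

variable {σ : ℝ → ℝ} {d k : ℕ} {ξ : X → Fin d → ℝ} {f : X → ℝ}

theorem NetLimit.fold (hσ : IsWeaklySigmoidal σ) (hf : Spread f)
    (h : NetLimit σ ξ k fun x => ![f x, 0, 0]) {L : ℝ} (hL : 0 < L) {n : ℕ} (hn : 0 < n) {m : ℕ}
    (hm : ∀ x, (Fintype.card X - 1) / n + ⌊f x / L⌋₊ ≤ m) :
    ∃ g : X → ℝ, Spread g ∧ (∀ x, g x < L + 2 * n * Fintype.card X) ∧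
      NetLimit σ ξ (k + m) fun x => ![g x, 0, 0] := by
  obtain ⟨κ, E, hmono, hκ, hspread, hlt⟩ := hf.exists_fold hL hn
  refine ⟨fun x => f x + E (κ x), hspread, hlt, ?_⟩
  have hadd := h.add_comp hσ κ 0 E
    (fun x x' i hi hi' => by simpa using hmono x x' (hi.trans_lt hi')) fun x => (hκ x).trans (hm x)
  exact hadd.affine₃ !![1, 1, 0; 0, 0, 0; 0, 0, 0] 0 (by simp) (by simp) (by simp)

theorem NetLimit.halve [Nonempty X] (hσ : IsWeaklySigmoidal σ) (hf : Spread f)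
    (h : NetLimit σ ξ k fun x => ![f x, 0, 0]) {D : ℝ} (hD : ∀ x, f x < D) (T : ℕ) :
    ∃ g : X → ℝ, Spread g ∧ (∀ x, g x < D / 2 ^ T + 4 * (Fintype.card X : ℝ) ^ 2) ∧
      NetLimit σ ξ (k + T) fun x => ![g x, 0, 0] := by
  have hD0 : 0 < D := (hf.nonneg (Classical.arbitrary X)).trans_lt (hD _)
  induction T with
  | zero =>
    refine ⟨f, hf, fun x => (hD x).trans_le ?_, h⟩
    rw [pow_zero, div_one]
    exact le_add_of_nonneg_right (by positivity)
  | succ T ih =>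
    obtain ⟨g, hg, hlt, hlim⟩ := ih
    set D' := D / 2 ^ T + 4 * (Fintype.card X : ℝ) ^ 2
    have hD' : 0 < D' / 2 := by positivity
    -- With blocks of `card X` points only the bit `⌊g x / (D' / 2)⌋` separates blocks.
    have hblock (x : X) : (Fintype.card X - 1) / Fintype.card X + ⌊g x / (D' / 2)⌋₊ ≤ 1 := by
      rw [Nat.div_eq_of_lt (Nat.sub_lt Fintype.card_pos one_pos), zero_add, ← Nat.lt_succ_iff,
        Nat.floor_lt (div_nonneg (hg.nonneg x) hD'.le), div_lt_iff₀ hD']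
      push_cast
      linarith [hlt x]
    obtain ⟨g', hg', hlt', hlim'⟩ := hlim.fold hσ hg hD' Fintype.card_pos hblock
    refine ⟨g', hg', fun x => (hlt' x).trans_eq ?_, hlim'⟩
    simp only [D', pow_succ]
    field

end Folding

section Memorization

variable {σ : ℝ → ℝ} {d k : ℕ} {X : Type*} {ξ : X → Fin d → ℝ} {f : X → ℝ}

theorem NetLimit.read_label [Finite X] (hσ : IsWeaklySigmoidal σ) (hf : Spread f)
    (h : NetLimit σ ξ k fun x => ![f x, 0, 0]) {n : ℕ} (hn : 0 < n) {m B : ℕ}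
    (hm : ∀ x, f x < n * (m + 1)) {y : X → ℕ} (hy : ∀ x, y x < 2 ^ B) :
    ∃ p : X → ℝ, NetLimit σ ξ (k + m + 3 * (n * B)) fun x => ![p x, y x, 0] := by
  have hn' : (0 : ℝ) < n := by exact_mod_cast hn
  let κ : X → ℕ := fun x => ⌊f x / n⌋₊
  let p : X → ℝ := fun x => f x - n * κ x
  have hp (x : X) : p x ∈ Set.Ico 0 (n : ℝ) := sub_mul_floor_mem_Ico (hf.nonneg x) hn'
  have hκ (x : X) : κ x ≤ m := by
    rw [← Nat.lt_succ_iff, Nat.floor_lt (div_nonneg (hf.nonneg x) hn'.le), div_lt_iff₀' hn']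
    simpa using hm x
  have hinj : Function.Injective fun x => (κ x, ⌊p x⌋₊) := by
    intro x x' h
    obtain ⟨hblock, hcell⟩ := Prod.mk.inj h
    by_contra hne
    refine (hf.one_le_abs_sub x x' hne).not_gt ?_
    have hfloor : ⌊p x⌋ = ⌊p x'⌋ := by
      rw [← Int.natCast_floor_eq_floor (hp x).1, ← Int.natCast_floor_eq_floor (hp x').1, hcell]
    simpa [p, hblock] using Int.abs_sub_lt_one_of_floor_eq_floor hfloor
  obtain ⟨e, he⟩ := exists_label_code (ξ := ξ) hσ κ hp hy (hinj.factorsThrough y)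
  have hmono (x x' : X) (i : ℕ) (_ : κ x ≤ i) (hi : i < κ x') :
      f x + -n * κ x < f x' + -n * i := by
    have hi' : (i : ℝ) + 1 ≤ κ x' := by exact_mod_cast hi
    have hstep : (n : ℝ) * (i + 1) ≤ n * κ x' := by gcongr
    linarith [(hp x).2, (hp x').1]
  have hadd := h.add_comp hσ κ (fun i => -n * i) e hmono hκ
  refine ⟨p, he (k + m) ?_⟩
  simpa only [neg_mul, ← sub_eq_add_neg, zero_add] using hadd

theorem NetLimit.memorize [Fintype X] [Nonempty X] (hσ : IsWeaklySigmoidal σ) (hf : Spread f)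
    (h : NetLimit σ ξ k fun x => ![f x, 0, 0]) {T a B : ℕ}
    (hT : ∀ x, f x < 2 ^ T * (Fintype.card X : ℝ) ^ 2) (ha : Fintype.card X ≤ a ^ 3)
    {y : X → ℕ} (hy : ∀ x, y x < 2 ^ B) :
    ∃ p : X → ℝ, NetLimit σ ξ (k + T + 6 * a ^ 2 + 3 * a ^ 2 + 3 * (a ^ 2 * B))
      fun x => ![p x, y x, 0] := by
  have ha0 : 0 < a := pos_of_ne_zero fun h0 => by
    simpa [h0] using Fintype.card_pos.trans_le ha
  have ha' : (Fintype.card X : ℝ) ≤ a ^ 3 := by exact_mod_cast ha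
  obtain ⟨g₁, hg₁, hlt₁, hlim₁⟩ := h.halve hσ hf hT T
  have hbound₁ (x : X) : g₁ x < 5 * a ^ 6 := by
    refine (hlt₁ x).trans_le ?_
    rw [mul_div_cancel_left₀ _ (by positivity)]
    calc _ = 5 * (Fintype.card X : ℝ) ^ 2 := by ring
      _ ≤ 5 * (a ^ 3) ^ 2 := by gcongr
      _ = 5 * a ^ 6 := by ring
  have hblock (x : X) : (Fintype.card X - 1) / a + ⌊g₁ x / (a : ℝ) ^ 4⌋₊ ≤ 6 * a ^ 2 := by
    have hrank : (Fintype.card X - 1) / a ≤ a ^ 2 :=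
      Nat.div_le_of_le_mul ((Nat.sub_le _ _).trans (ha.trans_eq (by ring)))
    have hfloor : ⌊g₁ x / (a : ℝ) ^ 4⌋₊ ≤ 5 * a ^ 2 := by
      refine Nat.floor_le_of_le ((div_le_iff₀ (by positivity)).2 ?_)
      push_cast
      exact (hbound₁ x).le.trans_eq (by ring)
    omega
  obtain ⟨g₂, hg₂, hlt₂, hlim₂⟩ := hlim₁.fold hσ hg₁ (by positivity) ha0 hblock
  refine hlim₂.read_label hσ hg₂ (n := a ^ 2) (m := 3 * a ^ 2) (by positivity) (fun x => ?_) hy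
  calc g₂ x < a ^ 4 + 2 * a * Fintype.card X := hlt₂ x
    _ ≤ a ^ 4 + 2 * a * a ^ 3 := by gcongr
    _ = a ^ 2 * (3 * a ^ 2) := by ring
    _ ≤ _ := by
      push_cast
      gcongr
      exact le_add_of_nonneg_right zero_le_one

end Memorization

section Depth

theorem exists_lt_two_pow {x : ℝ} (hx : 1 ≤ x) :
    ∃ n : ℕ, x < 2 ^ n ∧ (n : ℝ) ≤ Real.logb 2 x + 1 := by
  refine ⟨⌊Real.logb 2 x⌋₊ + 1, ?_, ?_⟩
  · rw [← Real.rpow_natCast, ← Real.logb_lt_iff_lt_rpow one_lt_two (one_pos.trans_le hx)]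
    exact_mod_cast Nat.lt_floor_add_one _
  · push_cast
    gcongr
    exact Nat.floor_le (Real.logb_nonneg one_lt_two hx)

theorem exists_le_pow_three {N : ℕ} (hN : 0 < N) :
    ∃ a : ℕ, N ≤ a ^ 3 ∧ (a : ℝ) ^ 2 ≤ 4 * (N : ℝ) ^ (2 / 3 : ℝ) := by
  let c := (N : ℝ) ^ (1 / 3 : ℝ)
  have hc : 1 ≤ c := Real.one_le_rpow (by exact_mod_cast hN) (by norm_num)
  have hpow (k : ℕ) : c ^ k = (N : ℝ) ^ (1 / 3 * k : ℝ) := by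
    rw [Real.rpow_mul_natCast N.cast_nonneg]
  refine ⟨⌈c⌉₊, ?_, ?_⟩
  · have hN' : (N : ℝ) = c ^ 3 := by simp [hpow]
    rw [← Nat.cast_le (α := ℝ), hN', Nat.cast_pow]
    gcongr
    exact Nat.le_ceil c
  · have hceil : (⌈c⌉₊ : ℝ) ≤ 2 * c := by
      linarith [Nat.ceil_lt_add_one (zero_le_one.trans hc)]
    calc (⌈c⌉₊ : ℝ) ^ 2 ≤ (2 * c) ^ 2 := by gcongr
      _ = 4 * c ^ 2 := by ring
      _ = _ := by rw [hpow]; norm_num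

theorem exists_depth_le {C N d : ℕ} {Δ : ℝ} (hC : 2 ≤ C) (hN : 0 < N) (hd : 0 < d)
    (hΔ : 1 ≤ Δ) :
    ∃ T a B : ℕ, 2 * (d : ℝ) ^ 2 * Δ < 2 ^ T ∧ N ≤ a ^ 3 ∧ C ≤ 2 ^ B ∧
      ((T + 6 * a ^ 2 + 3 * a ^ 2 + 3 * (a ^ 2 * B) : ℕ) : ℝ) ≤
        64 * max 1 (depthScale C N d Δ) := by
  have hd' : (1 : ℝ) ≤ d := by exact_mod_cast hd
  have hC' : (2 : ℝ) ≤ C := by exact_mod_cast hC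
  have hN' : (1 : ℝ) ≤ (N : ℝ) ^ (2 / 3 : ℝ) :=
    Real.one_le_rpow (by exact_mod_cast hN) (by norm_num)
  have hlogC : 1 ≤ Real.logb 2 C :=
    (Real.le_logb_iff_rpow_le one_lt_two (by linarith)).2 (by simpa using hC')
  obtain ⟨T, hT, hT_le⟩ := exists_lt_two_pow (x := 2 * (d : ℝ) ^ 2 * Δ) (by
    nlinarith [one_le_pow₀ hd' (n := 2)])
  obtain ⟨a, ha, ha_le⟩ := exists_le_pow_three hN
  obtain ⟨B, hB, hB_le⟩ := exists_lt_two_pow (x := C) (by linarith)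
  refine ⟨T, a, B, hT, ha, by exact_mod_cast hB.le, ?_⟩
  have hlogT : Real.logb 2 (2 * (d : ℝ) ^ 2 * Δ) =
      1 + 2 * Real.logb 2 d + Real.logb 2 Δ := by
    rw [Real.logb_mul (by positivity) (by positivity),
      Real.logb_mul (by positivity) (by positivity), Real.logb_pow,
      Real.logb_self_eq_one one_lt_two, Nat.cast_two]
  set c := (N : ℝ) ^ (2 / 3 : ℝ)
  have haB : (a : ℝ) ^ 2 * B ≤ 4 * c * (2 * Real.logb 2 C) := by
    gcongr
    linarith
  have hc : c ≤ c * Real.logb 2 C := le_mul_of_one_le_right (by positivity) hlogC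
  have hmax : (1 : ℝ) ≤ max 1 (depthScale C N d Δ) := le_max_left _ _
  have hscale : Real.logb 2 d + Real.logb 2 Δ + c * Real.logb 2 C ≤
      max 1 (depthScale C N d Δ) := le_max_right _ _
  have hlogd : 0 ≤ Real.logb 2 d := Real.logb_nonneg one_lt_two hd'
  have hlogΔ : 0 ≤ Real.logb 2 Δ := Real.logb_nonneg one_lt_two hΔ
  push_cast
  linarith

end Depth

section CanMemorize

variable {σ : ℝ → ℝ} {d C : ℕ} {Δ : ℝ} {X : Set (EuclideanSpace ℝ (Fin d))}

theorem canMemorize_of_val_eq_zero (ds : List ℕ) {y : X → Fin C} (hy : ∀ x, (y x : ℕ) = 0) :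
    CanMemorize σ ds X y := fun ε hε =>
  let ⟨θ, hθ⟩ := exists_netEval_eq_zero σ d ds
  ⟨θ, fun x => by simp [hθ, hy, hε.le]⟩

theorem IsDeltaSeparated.canMemorize (hX : IsDeltaSeparated Δ X) (hσ : IsWeaklySigmoidal σ)
    {T a B K : ℕ} (hT : 2 * (d : ℝ) ^ 2 * Δ < 2 ^ T) (ha : X.encard ≤ (a ^ 3 : ℕ))
    (hB : C ≤ 2 ^ B) (hK : T + 6 * a ^ 2 + 3 * a ^ 2 + 3 * (a ^ 2 * B) ≤ K) (y : X → Fin C) :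
    CanMemorize σ (List.replicate K 3) X y := by
  rcases isEmpty_or_nonempty X with _ | _
  · exact canMemorize_of_val_eq_zero _ isEmptyElim
  have := (Set.finite_of_encard_le_coe ha).fintype
  have hcard : Fintype.card X ≤ a ^ 3 := by
    rwa [← Set.coe_fintypeCard, Nat.cast_le] at ha
  obtain ⟨w, b, f, hf, hspread, hle⟩ := hX.exists_projection
  have hstart : NetLimit σ (fun (x : X) i => x.1 i) 0 fun x => ![f x, 0, 0] := by
    convert netLimit_zero ⟨Matrix.of ![w, 0, 0], ![b, 0, 0]⟩ using 2 with x
    ext i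
    fin_cases i <;> simp [AffineParams.apply, dotProduct, hf]
  have hlt (x : X) : f x < 2 ^ T * (Fintype.card X : ℝ) ^ 2 :=
    calc f x ≤ 2 * (Fintype.card X : ℝ) ^ 2 * d ^ 2 * Δ := hle x
      _ = 2 * (d : ℝ) ^ 2 * Δ * (Fintype.card X : ℝ) ^ 2 := by ring
      _ < _ := by gcongr
  obtain ⟨p, hp⟩ := hstart.memorize hσ hspread hlt hcard fun x => (y x).2.trans_le hB
  rw [zero_add] at hp
  exact fun ε hε => (hp.mono hσ hK).exists_netEval 1 hε

end CanMemorize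

theorem theorem2_general :
    ∃ c₁ c₂ : ℝ, 0 < c₁ ∧ 0 < c₂ ∧
      ∀ (C N d : ℕ) (Δ : ℝ), 0 < C → 0 < N → 0 < d → 1 ≤ Δ →
        ∃ ds : List ℕ,
          c₁ * max 1 (depthScale C N d Δ) ≤ (ds.length : ℝ) ∧
          (ds.length : ℝ) ≤ c₂ * max 1 (depthScale C N d Δ) ∧
          netWidth ds = 3 ∧ (∀ n ∈ ds, n = 3) ∧
          ∀ σ, IsWeaklySigmoidal σ → ∀ X : Set (EuclideanSpace ℝ (Fin d)), X.encard ≤ N →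
            IsDeltaSeparated Δ X → ∀ y : X → Fin C, CanMemorize σ ds X y := by
  refine ⟨1, 64, one_pos, by norm_num, fun C N d Δ hC hN hd hΔ => ?_⟩
  set q := max 1 (depthScale C N d Δ)
  have hq : 1 ≤ q := le_max_left _ _
  have hlower : 1 * q ≤ ⌊64 * q⌋₊ := by linarith [Nat.lt_floor_add_one (64 * q)]
  have hupper : (⌊64 * q⌋₊ : ℝ) ≤ 64 * q := Nat.floor_le (by positivity)
  have hpos : ⌊64 * q⌋₊ ≠ 0 := by
    rw [← Nat.pos_iff_ne_zero, Nat.floor_pos]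
    linarith
  refine ⟨List.replicate ⌊64 * q⌋₊ 3, by simpa using hlower, by simpa using hupper,
    netWidth_replicate hpos 3, fun n => List.eq_of_mem_replicate, fun σ hσ X hX hsep y => ?_⟩
  obtain rfl | hC2 : C = 1 ∨ 2 ≤ C := by omega
  · exact canMemorize_of_val_eq_zero _ fun x => Fin.val_eq_zero (y x)
  · obtain ⟨T, a, B, hT, ha, hB, hle⟩ := exists_depth_le hC2 hN hd hΔ
    exact hsep.canMemorize hσ hT (hX.trans (by exact_mod_cast ha)) hB (Nat.le_floor hle) y

theorem theorem2 :
    ∃ c₁ c₂ : ℝ, 0 < c₁ ∧ 0 < c₂ ∧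
      ∀ (C N d : ℕ) (Δ : ℝ) (σ : ℝ → ℝ), 0 < C → 0 < N → 0 < d → 1 ≤ Δ → IsSigmoidal σ →
        ∃ ds : List ℕ,
          c₁ * max 1 (depthScale C N d Δ) ≤ (ds.length : ℝ) ∧
          (ds.length : ℝ) ≤ c₂ * max 1 (depthScale C N d Δ) ∧
          netWidth ds = 3 ∧ (∀ n ∈ ds, n = 3) ∧
          ∀ X : Set (EuclideanSpace ℝ (Fin d)), X.encard = (N : ℕ∞) → IsDeltaSeparated Δ X →
            ∀ y : X → Fin C, CanMemorize σ ds X y := by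
  obtain ⟨c₁, c₂, hc₁, hc₂, h⟩ := theorem2_general
  refine ⟨c₁, c₂, hc₁, hc₂, fun C N d Δ σ hC hN hd hΔ hσ => ?_⟩
  obtain ⟨ds, hlower, hupper, hwidth, hall, hmem⟩ := h C N d Δ hC hN hd hΔ
  exact ⟨ds, hlower, hupper, hwidth, hall, fun X hX => hmem σ hσ.isWeaklySigmoidal X hX.le⟩
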